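/- Let $d\ge 1$, $p\in(0,2]$, $w>0$, let $c\ge 2$ be an integer, and for $\vec W=(w_1,\dots,w_d)$ with all $w_j>0$ let $D_{\vec W}(u,v)=\big(\sum_{j=1}^d|w_ju_j-w_jv_j|^p\big)^{1/p}$ for $u,v\in\mathbb{R}^d$. Fix a finite set $Q\subset\mathbb{R}^d$ of at least two possible points, and let $r_{min}^{\vec W}$ and $r_{max}^{\vec W}$ be the smallest and the largest distance under $\vec W$ between two distinct points of $Q$. Let $\mathcal S$ be a set of weight vectors with positive entries, $\mathcal S^\circ\subseteq\mathcal S$, $\vec{W^\circ}=(w^\circ_1,\dots,w^\circ_d)\in\mathcal S$, let $\rho$ be a real number with $\rho\ge r_{max}^{\vec W}/r_{min}^{\vec W}$ for all $\vec W\in\mathcal S^\circ$, and put $f=c^{\lceil\log_c\rho\rceil}$. Let $\vec a$ have $d$ independent entries with a fixed $p$-stable law $\mu$ (the characteristic function of $\mu$ is $t\mapsto\exp(-(\sigma|t|)^p)$ for some $\sigma>0$), let $b^*$ be independent of $\vec a$ and uniformly distributed on $[0,fw]$, and for $v\in\mathbb{R}^d$ and $l>0$ put $$h(v)=\Big\lfloor\frac{\sum_{j}a_jw^\circ_jv_j+b^*}{w}\Big\rfloor,\qquad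 h^l(v)=\Big\lfloor\frac{h(v)}{l}\Big\rfloor .$$ Let $F_p$ be the probability density function of $|\xi|$ for $\xi\sim\mu$, and for $r>0$ let $P_{l_p}(r)=\int_0^w\frac1rF_p\big(\frac tr\big)\big(1-\frac tw\big)\,dt$. A random hash function $g$ on $\mathbb{R}^d$ is called $(r_1,r_2,P_1,P_2)$-sensitive under $\vec W$ if for all $u,v\in\mathbb{R}^d$: $\Pr[g(u)=g(v)]\ge P_1$ whenever $D_{\vec W}(u,v)\le r_1$, and $\Pr[g(u)=g(v)]\le P_2$ whenever $D_{\vec W}(u,v)>r_2$. Theorem. Let $\vec{W_i}=(w_{i1},\dots,w_{id})\in\mathcal S^\circ$ and let $x,y$ be real numbers with $0<x^{\uparrow}<y^{\downarrow}$, where $x^{\uparrow}=x\max_{1\le j\le d}(w^\circ_j/w_{ij})$ and $y^{\downarrow}=y\min_{1\le j\le d}(w^\circ_j/w_{ij})$. Then: (1) the family derived from $\vec{W^\circ}$ for $\vec{W_i}$, that is, $h$ used under $\vec{W_i}$, is $(x,y,P_{l_p}(x^{\uparrow}),P_{l_p}(y^{\downarrow}))$-sensitive under $\vec{W_i}$;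 (2) for every $l\in\{c,c^2,\dots,c^{\lceil\log_c(r_{max}^{\vec{W_i}}/r_{min}^{\vec{W_i}})\rceil}\}$, the virtually rehashed family $h^l$ is $(xl,yl,P_{l_p}(x^{\uparrow}),P_{l_p}(y^{\downarrow}))$-sensitive under $\vec{W_i}$. -/

import Mathlib

open MeasureTheory ProbabilityTheory

namespace WLSH

noncomputable section

/-- The `l_p` distance on `ℝ^d` (a quasi-metric when `p < 1`). -/
def lpDist {d : ℕ} (p : ℝ) (x y : Fin d → ℝ) : ℝ :=
  (∑ i, |x i - y i| ^ p) ^ (1 / p)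

/-- The weighted `l_p` distance `D_W(x, y) = D(W ∘ x, W ∘ y)`, where `W ∘ x` is the entrywise
product. -/
def wDist {d : ℕ} (p : ℝ) (W x y : Fin d → ℝ) : ℝ :=
  lpDist p (W * x) (W * y)

/-- A random hash function `h` on `X` with law given by the probability space `(Ω, P)` is
`(r₁, r₂, P₁, P₂)`-sensitive for the distance function `D`: points of the closed ball of radius
`r₁` collide with probability at least `P₁`, and points outside of the closed ball of radius `r₂`
collide with probability at most `P₂`. -/
def IsSensitive {Ω X U : Type*} [MeasurableSpace Ω] (P : Measure Ω) (h : Ω → X → U)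
    (D : X → X → ℝ) (r₁ r₂ P₁ P₂ : ℝ) : Prop :=
  ∀ x y : X,
    (D x y ≤ r₁ → P₁ ≤ P.real {ω | h ω x = h ω y}) ∧
    (¬ D x y ≤ r₂ → P.real {ω | h ω x = h ω y} ≤ P₂)

/-- `μ` is a `p`-stable law on `ℝ`: its characteristic function is `t ↦ exp (-(σ |t|) ^ p)` for
some scale `σ > 0`. For `p = 2` these are the centred Gaussian laws (the standard normal law is
`σ = 1 / √2`), for `p = 1` the centred Cauchy laws. -/
def IsPStable (p : ℝ) (μ : Measure ℝ) : Prop :=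
  IsProbabilityMeasure μ ∧
    ∃ σ : ℝ, 0 < σ ∧ ∀ t : ℝ, charFun μ t = ((Real.exp (-(σ * |t|) ^ p) : ℝ) : ℂ)

/-- The probability density function of `|ξ|`, where `ξ` has law `μ`. -/
def absPdf (μ : Measure ℝ) (s : ℝ) : ℝ :=
  (pdf (fun ξ : ℝ => |ξ|) μ volume s).toReal

/-- The collision probability function
`P_{l_p}(r) = ∫_0^w (1 / r) F(t / r) (1 - t / w) dt`, where `F` is the density of the absolute
value of the stable law `μ`. -/
def collisionProb (μ : Measure ℝ) (w r : ℝ) : ℝ :=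
  ∫ t in (0 : ℝ)..w, 1 / r * absPdf μ (t / r) * (1 - t / w)

/-- The law of the random parameters `(a, b)`: the `d` entries of `a` are independent with law `μ`,
and `b` is independent of `a` and uniformly distributed on `[0, L]`. -/
def paramLaw (d : ℕ) (μ : Measure ℝ) (L : ℝ) : Measure ((Fin d → ℝ) × ℝ) :=
  (Measure.pi fun _ : Fin d => μ).prod (cond volume (Set.Icc 0 L))

/-- The hash function `h_{a,b}(x) = ⌊(a ⬝ x + b) / w⌋`. -/
def baseHash {d : ℕ} (w : ℝ) (ab : (Fin d → ℝ) × ℝ) (x : Fin d → ℝ) : ℤ :=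
  ⌊((∑ i, ab.1 i * x i) + ab.2) / w⌋

/-- The weighted hash function `h_{a,b,W}(x) = h_{a,b}(W ∘ x)`. -/
def wHash {d : ℕ} (w : ℝ) (W : Fin d → ℝ) (ab : (Fin d → ℝ) × ℝ) (x : Fin d → ℝ) : ℤ :=
  baseHash w ab (W * x)

/-- The virtually rehashed level-`l` weighted hash function
`h^l_{a,b,W}(x) = ⌊h_{a,b,W}(x) / l⌋`. -/
def wHashLevel {d : ℕ} (w l : ℝ) (W : Fin d → ℝ) (ab : (Fin d → ℝ) × ℝ) (x : Fin d → ℝ) : ℤ :=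
  ⌊(wHash w W ab x : ℝ) / l⌋

/-- A hash family built for `W`, derived for use under `W'`, hashes in the same way as the original
one and is then judged by the distance `D_{W'}`: sensitivity of the derived family. -/
def IsDerivedSensitive {Ω U : Type*} [MeasurableSpace Ω] {d : ℕ} (p : ℝ) (P : Measure Ω)
    (hW : Ω → (Fin d → ℝ) → U) (W' : Fin d → ℝ) (r₁ r₂ P₁ P₂ : ℝ) : Prop :=
  IsSensitive P hW (wDist p W') r₁ r₂ P₁ P₂

/-- The distances under `W` between two distinct points of `Q`. -/
def distances {d : ℕ} (p : ℝ) (Q : Set (Fin d → ℝ)) (W : Fin d → ℝ) : Set ℝ :=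
  {r | ∃ u ∈ Q, ∃ v ∈ Q, u ≠ v ∧ r = wDist p W u v}

/-- The smallest possible distance under `W` between two (distinct) points of `Q`. -/
def rMin {d : ℕ} (p : ℝ) (Q : Set (Fin d → ℝ)) (W : Fin d → ℝ) : ℝ :=
  sInf (distances p Q W)

/-- The largest possible distance under `W` between two points of `Q`. -/
def rMax {d : ℕ} (p : ℝ) (Q : Set (Fin d → ℝ)) (W : Fin d → ℝ) : ℝ :=
  sSup (distances p Q W)

/-- The number of levels `⌈log_c ρ⌉` for a ratio `ρ ≥ 1` of distances. -/
def levels (c : ℕ) (ρ : ℝ) : ℕ :=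
  ⌈Real.logb c ρ⌉₊

/-- `x^↑ = x * max_j (W_j / W'_j)`. -/
def up {d : ℕ} (W W' : Fin d → ℝ) (x : ℝ) : ℝ :=
  x * ⨆ j, W j / W' j

/-- `y^↓ = y * min_j (W_j / W'_j)`. -/
def down {d : ℕ} (W W' : Fin d → ℝ) (y : ℝ) : ℝ :=
  y * ⨅ j, W j / W' j

end

end WLSH

namespace WLSH

open Real Set

/-! Nested floors collapse, so the level `l` hash is an ordinary hash of cell width `w * l` with the
same `a` and offset (`floor_floor_div_div`). For `l = c ^ k` the offset range `[0, fw]` consists of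
a whole number of such cells. For fixed `a` the collision probability is therefore exactly `max 0 (1
- |a ⬝ z| / (w * l))`, where `z` is the difference of the weighted points
(`cond_volume_real_floor_eq`). By stability `a ⬝ z` is distributed as the `l_p` norm of `z` times
`ξ`, so two points at distance `D` under `W₀` collide with probability `E max 0 (1 - (D / l) |ξ| /
w)`.

This expectation is nonincreasing in `D / l`, and at `r > 0` it equals `P_{l_p}(r)`
(`collisionProb_eq_integral`). The extreme ratios of the weights bound `D` above and below by
multiples of the distance under `Wi`, which yields both inequalities.

The density in `P_{l_p}` determines the law only if `μ` is absolutely continuous, which follows from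
integrability of its characteristic function. -/

/-! ### Absolute continuity of stable laws. -/

theorem integrable_exp_neg_rpow_abs {p σ : ℝ} (hp : 0 < p) (hσ : 0 < σ) :
    Integrable fun t : ℝ => rexp (-(σ * |t|) ^ p) := by
  have h₂ : Integrable fun x : ℝ => rexp (-|x| ^ p) := by
    -- A non-integrable function has integral `0` by convention, whereas twice the half-line
    -- integral is a positive Gamma value.
    by_contra hn
    have h₁ := integral_comp_abs (f := fun x => rexp (-x ^ p))
    rw [integral_undef hn, integral_exp_neg_rpow hp] at h₁
    exact (mul_pos two_pos (Gamma_pos_of_pos (by positivity))).ne h₁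
  have h₃ := h₂.comp_mul_left' hσ.ne'
  simpa [abs_mul, abs_of_pos hσ] using h₃

/-- The Gaussian bump is the characteristic function of `N(0, v)` at `s - x`. Fubini moves the
Fourier transform onto `μ`, and the density of `N(0, v)` is at most `(√(2πv))⁻¹`. -/
theorem integral_exp_neg_sq_le {μ : Measure ℝ} [IsProbabilityMeasure μ]
    (hμ : Integrable (charFun μ)) (x : ℝ) {v : NNReal} (hv : v ≠ 0) :
    ∫ s, rexp (-(v * (s - x) ^ 2 / 2)) ∂μ ≤ (√(2 * π * v))⁻¹ * ∫ t, ‖charFun μ t‖ := by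
  have h₁ : ∀ s : ℝ, ((rexp (-(v * (s - x) ^ 2 / 2)) : ℝ) : ℂ)
      = ∫ t : ℝ, Complex.exp (((s - x : ℝ) : ℂ) * t * Complex.I) ∂(gaussianReal 0 v) := by
    intro s
    rw [← charFun_apply_real, charFun_gaussianReal]
    push_cast
    congr 1
    simp
  have hint : Integrable (Function.uncurry fun s t : ℝ =>
      Complex.exp (((s - x : ℝ) : ℂ) * t * Complex.I)) (μ.prod (gaussianReal 0 v)) := by
    refine Integrable.of_bound (C := 1) ?_ (ae_of_all _ fun q => ?_)
    · refine Continuous.aestronglyMeasurable ?_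
      simp only [Function.uncurry_def]
      fun_prop
    · simp only [Function.uncurry_def]
      rw [← Complex.ofReal_mul, Complex.norm_exp_ofReal_mul_I]
  have h₂ : ((∫ s, rexp (-(v * (s - x) ^ 2 / 2)) ∂μ : ℝ) : ℂ)
      = ∫ t : ℝ, Complex.exp (((-x * t : ℝ) : ℂ) * Complex.I) * charFun μ t
          ∂(gaussianReal 0 v) := by
    rw [← integral_complex_ofReal]
    simp_rw [h₁]
    rw [integral_integral_swap hint]
    refine integral_congr_ae (ae_of_all _ fun t => ?_)
    simp only
    rw [charFun_apply_real, ← integral_const_mul]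
    refine integral_congr_ae (ae_of_all _ fun s => ?_)
    simp only
    rw [← Complex.exp_add]
    congr 1
    push_cast
    ring
  calc ∫ s, rexp (-(v * (s - x) ^ 2 / 2)) ∂μ
      ≤ ‖((∫ s, rexp (-(v * (s - x) ^ 2 / 2)) ∂μ : ℝ) : ℂ)‖ := by
        rw [Complex.norm_real]; exact le_abs_self _
    _ ≤ ∫ t : ℝ, ‖Complex.exp (((-x * t : ℝ) : ℂ) * Complex.I) * charFun μ t‖
          ∂(gaussianReal 0 v) := by
        rw [h₂]; exact norm_integral_le_integral_norm _
    _ = ∫ t : ℝ, gaussianPDFReal 0 v t * ‖charFun μ t‖ := by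
        simp_rw [norm_mul, Complex.norm_exp_ofReal_mul_I, one_mul]
        rw [integral_gaussianReal_eq_integral_smul hv]
        rfl
    _ ≤ ∫ t : ℝ, (√(2 * π * v))⁻¹ * ‖charFun μ t‖ := by
        refine integral_mono_of_nonneg (ae_of_all _ fun t => ?_) (hμ.norm.const_mul _)
          (ae_of_all _ fun t => ?_)
        · exact mul_nonneg (gaussianPDFReal_nonneg _ _ _) (norm_nonneg _)
        · refine mul_le_mul_of_nonneg_right ?_ (norm_nonneg _)
          rw [gaussianPDFReal_def]
          refine mul_le_of_le_one_right (by positivity) (exp_le_one_iff.2 ?_)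
          rw [neg_div]
          exact neg_nonpos.2 (by positivity)
    _ = _ := integral_const_mul _ _

/-- With `v = (b - a)⁻²` the bump centred at `a` is at least `exp (-1/2)` on the interval, while the
factor `(√(2πv))⁻¹` is at most `b - a`. -/
theorem measureReal_Ioc_le_of_integrable_charFun {μ : Measure ℝ} [IsProbabilityMeasure μ]
    (hμ : Integrable (charFun μ)) {a b : ℝ} (hab : a < b) :
    μ.real (Ioc a b) ≤ (rexp (1 / 2) * ∫ t, ‖charFun μ t‖) * (b - a) := by
  have hv : 0 < (b - a)⁻¹ := inv_pos.2 (sub_pos.2 hab)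
  set v : NNReal := ⟨((b - a)⁻¹) ^ 2, by positivity⟩
  have hvc : (v : ℝ) = ((b - a)⁻¹) ^ 2 := rfl
  have hv0 : v ≠ 0 := by
    rw [← NNReal.coe_ne_zero, hvc]; positivity
  have hint : Integrable (fun s => rexp (-(v * (s - a) ^ 2 / 2))) μ := by
    refine Integrable.of_bound (C := 1) (Continuous.aestronglyMeasurable (by fun_prop))
      (ae_of_all _ fun s => ?_)
    rw [norm_of_nonneg (exp_pos _).le, exp_le_one_iff]
    exact neg_nonpos.2 (by positivity)
  have h₁ : rexp (-(1 / 2)) * μ.real (Ioc a b) ≤ ∫ s, rexp (-(v * (s - a) ^ 2 / 2)) ∂μ := by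
    calc rexp (-(1 / 2)) * μ.real (Ioc a b)
        ≤ ∫ s in Ioc a b, rexp (-(v * (s - a) ^ 2 / 2)) ∂μ := by
          refine setIntegral_ge_of_const_le_real measurableSet_Ioc (measure_ne_top _ _) ?_
            hint.integrableOn
          intro s hs
          refine exp_le_exp.2 ?_
          have : (v : ℝ) * (s - a) ^ 2 ≤ 1 := by
            rw [hvc, ← mul_pow]
            refine pow_le_one₀ (mul_nonneg hv.le (sub_nonneg.2 hs.1.le)) ?_
            rw [inv_mul_le_iff₀ (sub_pos.2 hab)]
            linarith [hs.2]
          linarith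
      _ ≤ _ := setIntegral_le_integral hint (ae_of_all _ fun s => (exp_pos _).le)
  have h₂ := h₁.trans (integral_exp_neg_sq_le hμ a hv0)
  have h₃ : (√(2 * π * v))⁻¹ ≤ b - a := by
    rw [inv_le_comm₀ (by positivity) (sub_pos.2 hab)]
    refine le_sqrt_of_sq_le ?_
    rw [hvc]
    refine le_mul_of_one_le_left (by positivity) ?_
    linarith [pi_gt_three]
  have h₄ := h₂.trans
    (mul_le_mul_of_nonneg_right h₃ (integral_nonneg fun t => norm_nonneg (charFun μ t)))
  calc μ.real (Ioc a b) = rexp (1 / 2) * (rexp (-(1 / 2)) * μ.real (Ioc a b)) := by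
        rw [← mul_assoc, ← exp_add]; simp
    _ ≤ _ := by
        rw [mul_assoc, mul_comm (∫ t, ‖charFun μ t‖)]
        exact mul_le_mul_of_nonneg_left h₄ (exp_pos _).le

/-- A probability law on the line with integrable characteristic function has a density. -/
theorem absolutelyContinuous_of_integrable_charFun {μ : Measure ℝ} [IsProbabilityMeasure μ]
    (hμ : Integrable (charFun μ)) : μ ≪ volume := by
  set C : NNReal := ⟨rexp (1 / 2) * ∫ t, ‖charFun μ t‖,
    mul_nonneg (exp_pos _).le (integral_nonneg fun _ => norm_nonneg _)⟩
  have hle : ∀ a b : ℝ, a ≤ b → cdf μ b - cdf μ a ≤ C * (b - a) := by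
    intro a b hab
    rcases hab.eq_or_lt with rfl | hab
    · simp
    have h := measureReal_Ioc_le_of_integrable_charFun hμ hab
    refine le_trans (le_of_eq ?_) h
    rw [measureReal_def]
    conv_rhs => rw [← measure_cdf μ]
    rw [StieltjesFunction.measure_Ioc, ENNReal.toReal_ofReal]
    exact sub_nonneg.2 ((cdf μ).mono hab.le)
  -- The Lipschitz bound makes `C x - cdf μ x` monotone; its measure is the slack in `μ ≤ C •
  -- volume`.
  let G : StieltjesFunction ℝ :=
    { toFun := fun x => C * x - cdf μ x
      mono' := fun a b hab => by
        have := hle a b hab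
        simp only
        linarith
      right_continuous' := fun x =>
        (Continuous.continuousWithinAt (by fun_prop)).sub ((cdf μ).right_continuous x) }
  have hsum : cdf μ + G = C • StieltjesFunction.id := by
    ext x
    change cdf μ x + (C * x - cdf μ x) = C * x
    ring
  have hm : μ + G.measure = C • volume := by
    rw [volume_eq_stieltjes_id, ← StieltjesFunction.measure_smul, ← hsum,
      StieltjesFunction.measure_add, measure_cdf]
  have hle' : μ ≤ C • volume := by
    rw [← hm]
    exact Measure.le_add_right le_rfl
  exact Measure.absolutelyContinuous_of_le_smul (c := (C : ENNReal)) hle'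

theorem IsPStable.absolutelyContinuous {p : ℝ} (hp : 0 < p) {μ : Measure ℝ}
    (hμ : IsPStable p μ) : μ ≪ volume := by
  obtain ⟨hprob, σ, hσ, hchar⟩ := hμ
  refine absolutelyContinuous_of_integrable_charFun ?_
  rw [show charFun μ = fun t => ((rexp (-(σ * |t|) ^ p) : ℝ) : ℂ) from funext hchar]
  exact (integrable_exp_neg_rpow_abs hp hσ).ofReal

/-! ### Collisions under a uniform offset. -/

theorem measurableSet_floor_eq (w α β : ℝ) :
    MeasurableSet {b : ℝ | ⌊(α + b) / w⌋ = ⌊(β + b) / w⌋} :=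
  measurableSet_eq_fun (by fun_prop) (by fun_prop)

/-- On the period starting at `-α` the first floor is `0`, so a collision means that the second
floor is `0` too. -/
theorem volume_real_period_inter_floor_eq {w : ℝ} (hw : 0 < w) {α β : ℝ} (h : α ≤ β) :
    volume.real (Ico (-α) (-α + w) ∩ {b : ℝ | ⌊(α + b) / w⌋ = ⌊(β + b) / w⌋})
      = max 0 (w - (β - α)) := by
  have : Ico (-α) (-α + w) ∩ {b : ℝ | ⌊(α + b) / w⌋ = ⌊(β + b) / w⌋} = Ico (-α) (w - β) := by
    ext b
    simp only [mem_inter_iff, mem_Ico, mem_ofPred_eq]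
    have h₀ : -α ≤ b → b < -α + w → ⌊(α + b) / w⌋ = 0 := fun h₁ h₂ => by
      rw [Int.floor_eq_zero_iff, mem_Ico]
      exact ⟨div_nonneg (by linarith) hw.le, (div_lt_one hw).2 (by linarith)⟩
    constructor
    · rintro ⟨⟨h₁, h₂⟩, h₃⟩
      rw [h₀ h₁ h₂, eq_comm, Int.floor_eq_zero_iff, mem_Ico, div_lt_one hw] at h₃
      exact ⟨h₁, by linarith [h₃.2]⟩
    · rintro ⟨h₁, h₂⟩
      have h₃ : b < -α + w := by linarith
      refine ⟨⟨h₁, h₃⟩, ?_⟩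
      rw [h₀ h₁ h₃, eq_comm, Int.floor_eq_zero_iff, mem_Ico, div_lt_one hw]
      exact ⟨div_nonneg (by linarith) hw.le, by linarith⟩
  rw [this, measureReal_def, Real.volume_Ico, ENNReal.toReal_ofReal', max_comm]
  congr 1
  ring

/-- The collision set is `w`-periodic in the offset. Its measure in `[0, n * w]` is thus `n` times
that in any single period, in particular the one starting at `-α`. -/
theorem cond_volume_real_floor_eq {w : ℝ} (hw : 0 < w) {n : ℕ} (hn : 0 < n) (α β : ℝ) :
    (cond volume (Icc 0 (n * w))).real {b : ℝ | ⌊(α + b) / w⌋ = ⌊(β + b) / w⌋}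
      = max 0 (1 - |α - β| / w) := by
  wlog h : α ≤ β generalizing α β
  · rw [abs_sub_comm, ← this β α (le_of_not_ge h)]
    congr 1
    ext b
    exact eq_comm
  set E := {b : ℝ | ⌊(α + b) / w⌋ = ⌊(β + b) / w⌋} with hE
  have hEm : MeasurableSet E := measurableSet_floor_eq w α β
  have hper : Function.Periodic (E.indicator (1 : ℝ → ℝ)) w := by
    intro b
    have : b + w ∈ E ↔ b ∈ E := by
      simp only [hE, mem_ofPred_eq, ← add_assoc, add_div _ w w, div_self hw.ne', Int.floor_add_one,
        add_left_inj]
    by_cases hb : b ∈ E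
    · rw [indicator_of_mem hb, indicator_of_mem (this.2 hb)]; rfl
    · rw [indicator_of_notMem hb, indicator_of_notMem (mt this.1 hb)]
  have hint : ∀ t₁ t₂, IntervalIntegrable (E.indicator (1 : ℝ → ℝ)) volume t₁ t₂ := fun t₁ t₂ => by
    rw [intervalIntegrable_iff]
    exact IntegrableOn.indicator (integrableOn_const (by simp [uIoc])) hEm
  have hnw : 0 < n * w := by positivity
  have h₁ := hper.intervalIntegral_add_zsmul_eq n 0 hint
  rw [hper.intervalIntegral_add_eq 0 (-α), zero_add, zsmul_eq_mul, zsmul_eq_mul, Int.cast_natCast,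
    intervalIntegral.integral_of_le hnw.le, intervalIntegral.integral_of_le (by linarith),
    ← integral_Icc_eq_integral_Ioc, ← integral_Ico_eq_integral_Ioc, integral_indicator_one hEm,
    integral_indicator_one hEm, measureReal_restrict_apply hEm, measureReal_restrict_apply hEm,
    inter_comm E, inter_comm E, volume_real_period_inter_floor_eq hw h] at h₁
  rw [measureReal_def, cond_apply measurableSet_Icc, ENNReal.toReal_mul, ENNReal.toReal_inv,
    ← measureReal_def, ← measureReal_def, h₁, Real.volume_real_Icc_of_le hnw.le, sub_zero,
    abs_sub_comm, abs_of_nonneg (sub_nonneg.2 h), mul_inv, mul_mul_mul_comm,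
    inv_mul_cancel₀ (by positivity), one_mul, mul_max_of_nonneg _ _ (inv_pos.2 hw).le]
  congr 1
  · simp
  · field_simp

theorem floor_floor_div_div (z w : ℝ) (l : ℕ) :
    ⌊(⌊z / w⌋ : ℝ) / (l : ℝ)⌋ = ⌊z / (w * l)⌋ := by
  rw [Int.floor_div_natCast, Int.floor_intCast, ← Int.floor_div_natCast, div_div]

/-! ### The collision probability as an expectation. -/

theorem map_abs_absolutelyContinuous {μ : Measure ℝ} (hμ : μ ≪ volume) :
    μ.map (fun ξ : ℝ => |ξ|) ≪ volume := by
  refine Measure.AbsolutelyContinuous.mk fun N hN hN0 => ?_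
  rw [Measure.map_apply measurable_abs hN]
  refine hμ (measure_mono_null (t := N ∪ -N) (fun ξ hξ => ?_) (measure_union_null hN0 ?_))
  · rcases abs_choice ξ with h | h <;> simp_all
  · rwa [Measure.measure_neg]

/-- Substituting `t = r s` turns the integral into one of `1 - r s / w` against the law of `|ξ|` on
`(0, w / r]`; beyond `w / r` the positive part vanishes. -/
theorem collisionProb_eq_integral {μ : Measure ℝ} [IsFiniteMeasure μ] (hμ : μ ≪ volume)
    {w r : ℝ} (hw : 0 < w) (hr : 0 < r) :
    collisionProb μ w r = ∫ ξ, max 0 (1 - r * |ξ| / w) ∂μ := by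
  set ν := μ.map (fun ξ : ℝ => |ξ|)
  have hν : ν ≪ volume := map_abs_absolutelyContinuous hμ
  have h₁ : collisionProb μ w r
      = ∫ t in (0 : ℝ)..w, r⁻¹ * ((fun s => absPdf μ s * (1 - r * s / w)) (t / r)) := by
    refine intervalIntegral.integral_congr fun t _ => ?_
    simp only
    rw [mul_div_cancel₀ _ hr.ne', one_div, mul_assoc]
  have h₂ : ∫ ξ, max 0 (1 - r * |ξ| / w) ∂μ = ∫ s, max 0 (1 - r * s / w) ∂ν :=
    (integral_map (f := fun s => max 0 (1 - r * s / w)) measurable_abs.aemeasurable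
      (Continuous.aestronglyMeasurable (by fun_prop))).symm
  -- The law of `|ξ|` has no atom at `0`, so nothing is lost on the half-open interval.
  have hpos : ∀ᵐ s ∂ν, 0 < s := by
    have h₀ : ∀ᵐ s ∂ν, s ≠ 0 := hν.ae_le (Measure.ae_ne volume 0)
    have h₀' : ∀ᵐ s ∂ν, 0 ≤ s :=
      (ae_map_iff measurable_abs.aemeasurable measurableSet_Ici).2 (ae_of_all _ abs_nonneg)
    filter_upwards [h₀, h₀'] with s h h' using lt_of_le_of_ne h' h.symm
  rw [h₁, intervalIntegral.integral_const_mul, intervalIntegral.integral_comp_div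
      (fun s => absPdf μ s * (1 - r * s / w)) hr.ne', zero_div, smul_eq_mul,
    inv_mul_cancel_left₀ hr.ne', intervalIntegral.integral_of_le (by positivity), h₂]
  change ∫ s in Ioc 0 (w / r), (ν.rnDeriv volume s).toReal • (1 - r * s / w) = _
  rw [setIntegral_rnDeriv_smul hν measurableSet_Ioc, ← integral_indicator measurableSet_Ioc]
  refine integral_congr_ae ?_
  filter_upwards [hpos] with s hs
  by_cases hsw : s ≤ w / r
  · rw [indicator_of_mem (show s ∈ Ioc 0 (w / r) from ⟨hs, hsw⟩), max_eq_right]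
    rw [sub_nonneg, div_le_one hw, mul_comm]
    exact (le_div_iff₀ hr).1 hsw
  · rw [indicator_of_notMem (fun h => hsw h.2), max_eq_left]
    rw [sub_nonpos, one_le_div hw, mul_comm]
    exact (div_le_iff₀ hr).1 (not_le.1 hsw).le

theorem integral_max_zero_one_sub_antitone (μ : Measure ℝ) [IsFiniteMeasure μ] {w r r' : ℝ}
    (hw : 0 < w) (hr : 0 ≤ r) (h : r ≤ r') :
    ∫ ξ, max 0 (1 - r' * |ξ| / w) ∂μ ≤ ∫ ξ, max 0 (1 - r * |ξ| / w) ∂μ := by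
  have hint : ∀ q, 0 ≤ q → Integrable (fun ξ : ℝ => max 0 (1 - q * |ξ| / w)) μ := fun q hq =>
    Integrable.of_bound (C := 1) (Continuous.aestronglyMeasurable (by fun_prop))
      (ae_of_all _ fun ξ => by
        rw [norm_of_nonneg (le_max_left _ _)]
        exact max_le zero_le_one (sub_le_self _ (by positivity)))
  refine integral_mono (hint r' (hr.trans h)) (hint r hr) fun ξ => ?_
  simp only
  gcongr

/-- Linear combinations of independent variables with a `p`-stable law are multiples of one such
variable. -/
theorem IsPStable.map_sum_mul_pi {p : ℝ} (hp : 0 < p) {μ : Measure ℝ} (hμ : IsPStable p μ)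
    {d : ℕ} (s : Fin d → ℝ) :
    (Measure.pi fun _ : Fin d => μ).map (fun a => ∑ i, a i * s i)
      = μ.map (fun ξ => (∑ i, |s i| ^ p) ^ (1 / p) * ξ) := by
  obtain ⟨hprob, σ, hσ, hchar⟩ := hμ
  have : IsFiniteMeasure ((Measure.pi fun _ : Fin d => μ).map fun a => ∑ i, a i * s i) :=
    Measure.isFiniteMeasure_map _ _
  have : IsFiniteMeasure (μ.map (fun ξ => (∑ i, |s i| ^ p) ^ (1 / p) * ξ)) :=
    Measure.isFiniteMeasure_map _ _
  refine Measure.ext_of_charFun (funext fun t => ?_)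
  rw [charFun_map_mul, hchar, charFun_apply_real,
    integral_map (Measurable.aemeasurable (by fun_prop))
      (Continuous.aestronglyMeasurable (by fun_prop))]
  -- Independence: the integrand factors over the coordinates, and in the product of characteristic
  -- functions the `p`-th powers add up.
  have h₁ : ∀ a : Fin d → ℝ, Complex.exp (t * ((∑ i, a i * s i : ℝ) : ℂ) * Complex.I)
      = ∏ i, Complex.exp (((t * s i : ℝ) : ℂ) * a i * Complex.I) := fun a => by
    rw [← Complex.exp_sum]
    congr 1
    push_cast
    rw [Finset.mul_sum, Finset.sum_mul]
    exact Finset.sum_congr rfl fun i _ => by ring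
  simp_rw [h₁]
  rw [integral_fintype_prod_eq_prod
    (f := fun i (z : ℝ) => Complex.exp (((t * s i : ℝ) : ℂ) * z * Complex.I))]
  simp_rw [← charFun_apply_real, hchar]
  rw [← Complex.ofReal_prod, ← exp_sum, Finset.sum_neg_distrib]
  have hS : 0 ≤ ∑ i, |s i| ^ p := Finset.sum_nonneg fun i _ => by positivity
  congr 3
  rw [abs_mul, abs_of_nonneg (rpow_nonneg hS _), ← mul_assoc, mul_comm σ, mul_assoc,
    mul_rpow (rpow_nonneg hS _) (by positivity), ← rpow_mul hS, one_div_mul_cancel hp.ne', rpow_one,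
    Finset.sum_mul]
  refine Finset.sum_congr rfl fun i _ => ?_
  rw [abs_mul, ← mul_assoc, mul_comm, mul_rpow (by positivity) (by positivity)]

/-- The collision probability of `u` and `v`, for an offset that is uniform over a
whole number of cells. -/
theorem paramLaw_real_floor_eq {p : ℝ} (hp : 0 < p) {μ : Measure ℝ} (hμ : IsPStable p μ) {d : ℕ}
    {w : ℝ} (hw : 0 < w) {n : ℕ} (hn : 0 < n) (u v : Fin d → ℝ) :
    (paramLaw d μ (n * w)).real {ab | baseHash w ab u = baseHash w ab v}
      = ∫ ξ, max 0 (1 - lpDist p u v * |ξ| / w) ∂μ := by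
  have := hμ.1
  have hE : MeasurableSet {ab : (Fin d → ℝ) × ℝ | baseHash w ab u = baseHash w ab v} :=
    measurableSet_eq_fun (by unfold baseHash; fun_prop) (by unfold baseHash; fun_prop)
  have : IsProbabilityMeasure (cond volume (Icc 0 (n * w))) :=
    cond_isProbabilityMeasure_of_finite
      (by rw [Real.volume_Icc, sub_zero, ENNReal.ofReal_ne_zero_iff]; positivity)
      measure_Icc_lt_top.ne
  -- Conditioning on `a` leaves only the uniform offset.
  have h₁ : (paramLaw d μ (n * w)).real {ab | baseHash w ab u = baseHash w ab v}
      = ∫ a, max 0 (1 - |∑ i, a i * (u i - v i)| / w) ∂(Measure.pi fun _ : Fin d => μ) := by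
    rw [measureReal_def, paramLaw, Measure.prod_apply hE, ← integral_toReal
      (measurable_measure_prodMk_left hE).aemeasurable (ae_of_all _ fun a => measure_lt_top _ _)]
    refine integral_congr_ae (ae_of_all _ fun a => ?_)
    simp only
    rw [← measureReal_def]
    refine (cond_volume_real_floor_eq hw hn (∑ i, a i * u i) (∑ i, a i * v i)).trans ?_
    rw [← Finset.sum_sub_distrib]
    simp_rw [mul_sub]
  rw [h₁, ← integral_map (φ := fun a : Fin d → ℝ => ∑ i, a i * (u i - v i))
      (f := fun z : ℝ => max 0 (1 - |z| / w)) (Measurable.aemeasurable (by fun_prop))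
      (Continuous.aestronglyMeasurable (by fun_prop)),
    hμ.map_sum_mul_pi hp, integral_map (Measurable.aemeasurable (by fun_prop))
      (Continuous.aestronglyMeasurable (by fun_prop))]
  refine integral_congr_ae (ae_of_all _ fun ξ => ?_)
  simp only [lpDist]
  rw [abs_mul, abs_of_nonneg (a := _ ^ _) (by positivity)]

/-! ### Comparison of weighted distances and of level counts. -/

theorem lpDist_nonneg {d : ℕ} (p : ℝ) (u v : Fin d → ℝ) : 0 ≤ lpDist p u v := by
  unfold lpDist
  positivity

theorem lpDist_mono {d : ℕ} {p : ℝ} (hp : 0 < p) {u v u' v' : Fin d → ℝ}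
    (h : ∀ j, |u j - v j| ≤ |u' j - v' j|) : lpDist p u v ≤ lpDist p u' v' := by
  unfold lpDist
  refine rpow_le_rpow (by positivity) (Finset.sum_le_sum fun j _ => ?_) (by positivity)
  exact rpow_le_rpow (abs_nonneg _) (h j) hp.le

theorem lpDist_smul {d : ℕ} {p : ℝ} (hp : 0 < p) {m : ℝ} (hm : 0 ≤ m) (u v : Fin d → ℝ) :
    lpDist p (m • u) (m • v) = m * lpDist p u v := by
  unfold lpDist
  have h : ∀ i, |(m • u) i - (m • v) i| ^ p = m ^ p * |u i - v i| ^ p := fun i => by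
    rw [Pi.smul_apply, Pi.smul_apply, smul_eq_mul, smul_eq_mul, ← mul_sub, abs_mul, abs_of_nonneg hm,
      mul_rpow hm (abs_nonneg _)]
  simp_rw [h]
  rw [← Finset.mul_sum, mul_rpow (by positivity) (by positivity), ← rpow_mul hm,
    mul_one_div_cancel hp.ne', rpow_one]

/-- Each `W j` is at most the largest ratio times `W' j`, and the `l_p` distance is homogeneous and
monotone in the coordinate differences. -/
theorem wDist_le_iSup_mul {d : ℕ} {p : ℝ} (hp : 0 < p) {W W' : Fin d → ℝ} (hW : ∀ j, 0 < W j)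
    (hW' : ∀ j, 0 < W' j) (u v : Fin d → ℝ) :
    wDist p W u v ≤ (⨆ j, W j / W' j) * wDist p W' u v := by
  have hM : 0 ≤ ⨆ j, W j / W' j := iSup_nonneg fun j => (div_pos (hW j) (hW' j)).le
  unfold wDist
  rw [← lpDist_smul hp hM]
  refine lpDist_mono hp fun j => ?_
  simp only [Pi.smul_apply, Pi.mul_apply, smul_eq_mul]
  rw [← mul_sub, ← mul_sub, ← mul_sub, ← mul_assoc, abs_mul, abs_mul, abs_of_pos (hW j),
    abs_of_nonneg (mul_nonneg hM (hW' j).le)]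
  refine mul_le_mul_of_nonneg_right ?_ (abs_nonneg _)
  rw [← div_le_iff₀ (hW' j)]
  exact le_ciSup (f := fun j => W j / W' j) (finite_range _).bddAbove j

theorem iInf_mul_wDist_le {d : ℕ} {p : ℝ} (hp : 0 < p) {W W' : Fin d → ℝ} (hW : ∀ j, 0 < W j)
    (hW' : ∀ j, 0 < W' j) (u v : Fin d → ℝ) :
    (⨅ j, W j / W' j) * wDist p W' u v ≤ wDist p W u v := by
  have hm : 0 ≤ ⨅ j, W j / W' j := iInf_nonneg fun j => (div_pos (hW j) (hW' j)).le
  unfold wDist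
  rw [← lpDist_smul hp hm]
  refine lpDist_mono hp fun j => ?_
  simp only [Pi.smul_apply, Pi.mul_apply, smul_eq_mul]
  rw [← mul_sub, ← mul_sub, ← mul_sub, ← mul_assoc, abs_mul,
    abs_mul (W j), abs_of_pos (hW j), abs_of_nonneg (mul_nonneg hm (hW' j).le)]
  refine mul_le_mul_of_nonneg_right ?_ (abs_nonneg _)
  rw [← le_div_iff₀ (hW' j)]
  exact ciInf_le (f := fun j => W j / W' j) (finite_range _).bddBelow j

theorem wDist_pos {d : ℕ} {p : ℝ} {W u v : Fin d → ℝ} (hW : ∀ j, 0 < W j) (huv : u ≠ v) :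
    0 < wDist p W u v := by
  obtain ⟨j, hj⟩ := Function.ne_iff.1 huv
  refine rpow_pos_of_pos (Finset.sum_pos' (fun i _ => by positivity) ⟨j, Finset.mem_univ j, ?_⟩) _
  refine rpow_pos_of_pos (abs_pos.2 ?_) _
  rw [Pi.mul_apply, Pi.mul_apply, ← mul_sub]
  exact mul_ne_zero (hW j).ne' (sub_ne_zero.2 hj)

theorem finite_distances {d : ℕ} (p : ℝ) {Q : Set (Fin d → ℝ)} (hQ : Q.Finite) (W : Fin d → ℝ) :
    (distances p Q W).Finite := by
  refine (hQ.image2 (wDist p W) hQ).subset ?_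
  rintro _ ⟨u, hu, v, hv, -, rfl⟩
  exact mem_image2_of_mem hu hv

/-- A finite nonempty set of distances attains its extrema, and all its elements are positive.
Positivity is what monotonicity of the logarithm needs. -/
theorem rMax_div_rMin_pos {d : ℕ} (p : ℝ) {Q : Set (Fin d → ℝ)} (hQfin : Q.Finite)
    (hQ : Q.Nontrivial) {W : Fin d → ℝ} (hW : ∀ j, 0 < W j) : 0 < rMax p Q W / rMin p Q W := by
  have hpos : ∀ r ∈ distances p Q W, 0 < r := by
    rintro _ ⟨u, -, v, -, huv, rfl⟩
    exact wDist_pos hW huv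
  have hne : (distances p Q W).Nonempty := by
    obtain ⟨u, hu, v, hv, huv⟩ := hQ
    exact ⟨_, u, hu, v, hv, huv, rfl⟩
  have hfin := finite_distances p hQfin W
  exact div_pos (hpos _ (hne.csSup_mem hfin)) (hpos _ (hne.csInf_mem hfin))

theorem levels_mono {c : ℕ} (hc : 2 ≤ c) {ρ ρ' : ℝ} (hρ : 0 < ρ) (h : ρ ≤ ρ') :
    levels c ρ ≤ levels c ρ' :=
  Nat.ceil_mono (logb_le_logb_of_le (by exact_mod_cast hc) hρ h)

/-! ### Sensitivity at every level. -/

theorem wHashLevel_eq_baseHash {d : ℕ} (w : ℝ) (l : ℕ) (W : Fin d → ℝ) (ab : (Fin d → ℝ) × ℝ)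
    (u : Fin d → ℝ) : wHashLevel w l W ab u = baseHash (w * l) ab (W * u) :=
  floor_floor_div_div _ _ _

/-- Widening the cells by `l` has the effect of dividing distances by `l`, so radii scaled by `l`
keep the same probabilities. Here `n` counts the wide cells in the offset range. -/
theorem isDerivedSensitive_wHashLevel {d : ℕ} {p : ℝ} (hp : 0 < p) {μ : Measure ℝ}
    (hμ : IsPStable p μ) {w : ℝ} (hw : 0 < w) {l n : ℕ} (hl : 0 < l) (hn : 0 < n)
    {W W' : Fin d → ℝ} (hW : ∀ j, 0 < W j) (hW' : ∀ j, 0 < W' j) {x y : ℝ}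
    (hx : 0 < up W W' x) (hy : 0 < down W W' y) :
    IsDerivedSensitive p (paramLaw d μ (n * (w * l))) (wHashLevel w l W) W' (x * l) (y * l)
      (collisionProb μ w (up W W' x)) (collisionProb μ w (down W W' y)) := by
  have := hμ.1
  have hl' : (0 : ℝ) < l := by exact_mod_cast hl
  have hac := hμ.absolutelyContinuous hp
  have hM : 0 ≤ ⨆ j, W j / W' j := iSup_nonneg fun j => (div_pos (hW j) (hW' j)).le
  have hm : 0 ≤ ⨅ j, W j / W' j := iInf_nonneg fun j => (div_pos (hW j) (hW' j)).le
  intro u v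
  have hprob : (paramLaw d μ (n * (w * l))).real
      {ab | wHashLevel w l W ab u = wHashLevel w l W ab v}
        = ∫ ξ, max 0 (1 - wDist p W u v / l * |ξ| / w) ∂μ := by
    simp_rw [wHashLevel_eq_baseHash]
    rw [paramLaw_real_floor_eq hp hμ (mul_pos hw hl') hn]
    refine integral_congr_ae (ae_of_all _ fun ξ => ?_)
    simp only [wDist]
    congr 2
    field_simp
  rw [hprob, collisionProb_eq_integral hac hw hx, collisionProb_eq_integral hac hw hy]
  constructor
  · intro hD
    refine integral_max_zero_one_sub_antitone μ hw (div_nonneg (lpDist_nonneg _ _ _) hl'.le) ?_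
    rw [div_le_iff₀ hl']
    calc wDist p W u v ≤ _ := wDist_le_iSup_mul hp hW hW' u v
      _ ≤ (⨆ j, W j / W' j) * (x * l) := mul_le_mul_of_nonneg_left hD hM
      _ = _ := by unfold up; ring
  · intro hD
    refine integral_max_zero_one_sub_antitone μ hw hy.le ?_
    rw [le_div_iff₀ hl']
    calc down W W' y * l = (⨅ j, W j / W' j) * (y * l) := by unfold down; ring
      _ ≤ (⨅ j, W j / W' j) * wDist p W' u v := mul_le_mul_of_nonneg_left (not_le.1 hD).le hm
      _ ≤ _ := iInf_mul_wDist_le hp hW hW' u v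

end WLSH

theorem theorem2
    (d : ℕ) (hd : 1 ≤ d)
    (p : ℝ) (hp0 : 0 < p) (hp2 : p ≤ 2)
    (μ : Measure ℝ) (hμ : WLSH.IsPStable p μ)
    (w : ℝ) (hw : 0 < w)
    (c : ℕ) (hc : 2 ≤ c)
    -- the finite set of points between which distances are possible
    (Q : Set (Fin d → ℝ)) (hQfin : Q.Finite) (hQ : Q.Nontrivial)
    -- the weight vectors
    (S : Set (Fin d → ℝ)) (hS : ∀ W ∈ S, ∀ j, 0 < W j)
    (S₀ : Set (Fin d → ℝ)) (hS₀ : S₀ ⊆ S)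
    (W₀ : Fin d → ℝ) (hW₀ : W₀ ∈ S)
    -- the bound on the ratios of the distances, which fixes the range of the offset
    (ρ : ℝ) (hρ : ∀ W ∈ S₀, WLSH.rMax p Q W / WLSH.rMin p Q W ≤ ρ)
    (Wi : Fin d → ℝ) (hWi : Wi ∈ S₀)
    (x y : ℝ) (hx : 0 < WLSH.up W₀ Wi x) (hxy : WLSH.up W₀ Wi x < WLSH.down W₀ Wi y) :
    WLSH.IsDerivedSensitive p
      (WLSH.paramLaw d μ ((c : ℝ) ^ WLSH.levels c ρ * w))
      (WLSH.wHash w W₀) Wi x y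
      (WLSH.collisionProb μ w (WLSH.up W₀ Wi x))
      (WLSH.collisionProb μ w (WLSH.down W₀ Wi y)) ∧
    ∀ k : ℕ, 1 ≤ k → k ≤ WLSH.levels c (WLSH.rMax p Q Wi / WLSH.rMin p Q Wi) →
      WLSH.IsDerivedSensitive p
        (WLSH.paramLaw d μ ((c : ℝ) ^ WLSH.levels c ρ * w))
        (WLSH.wHashLevel w ((c : ℝ) ^ k) W₀) Wi (x * (c : ℝ) ^ k) (y * (c : ℝ) ^ k)
        (WLSH.collisionProb μ w (WLSH.up W₀ Wi x))
        (WLSH.collisionProb μ w (WLSH.down W₀ Wi y)) := by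
  have hW₀pos := hS W₀ hW₀
  have hWipos := hS Wi (hS₀ hWi)
  have hc0 : 0 < c := by omega
  -- Since `f` is a power of `c`, the range `[0, fw]` splits into exactly `f / c ^ k` cells of width
  -- `w * c ^ k`. The case `k = 0` is the unrehashed family.
  have key : ∀ k ≤ WLSH.levels c ρ, WLSH.IsDerivedSensitive p
      (WLSH.paramLaw d μ ((c : ℝ) ^ WLSH.levels c ρ * w))
      (WLSH.wHashLevel w ((c : ℝ) ^ k) W₀) Wi (x * (c : ℝ) ^ k) (y * (c : ℝ) ^ k)
      (WLSH.collisionProb μ w (WLSH.up W₀ Wi x))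
      (WLSH.collisionProb μ w (WLSH.down W₀ Wi y)) := by
    intro k hk
    have h := WLSH.isDerivedSensitive_wHashLevel hp0 hμ hw (pow_pos hc0 k)
      (pow_pos hc0 (WLSH.levels c ρ - k)) hW₀pos hWipos hx (hx.trans hxy)
    have hL : ((c ^ (WLSH.levels c ρ - k) : ℕ) : ℝ) * (w * ((c ^ k : ℕ) : ℝ))
        = (c : ℝ) ^ WLSH.levels c ρ * w := by
      push_cast
      rw [mul_left_comm, ← pow_add, Nat.sub_add_cancel hk, mul_comm]
    rw [hL] at h
    simpa only [Nat.cast_pow] using h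
  refine ⟨?_, fun k _ hk => key k (hk.trans
    (WLSH.levels_mono hc (WLSH.rMax_div_rMin_pos p hQfin hQ hWipos) (hρ Wi hWi)))⟩
  have h := key 0 (Nat.zero_le _)
  have h₁ : WLSH.wHashLevel w ((c : ℝ) ^ 0) W₀ = WLSH.wHash w W₀ := by
    funext ab u
    simp [WLSH.wHashLevel]
  rwa [h₁, pow_zero, mul_one, mul_one] at h
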